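/- Let $N\ge 1$ be an integer, let $u$ be a scalar unknown and $U=(U_1,\dots,U_N)$ a vector unknown depending on $x$ and a time variable, and write $\langle \partial_x^mU,\partial_x^nU\rangle=\sum_{j=1}^N(\partial_x^mU_j)(\partial_x^nU_j)$. Consider the general second-order system that is homogeneous for the weights $\lambda_1=\tfrac23$ of $u$ and $\lambda_2=\tfrac13$ of $U$ (with $\partial_x$ of weight $1$), $$ \begin{aligned} u_{t_2}&=a_1u_{xx}+a_2u^4+a_3\langle U,U_{xx}\rangle+a_4\langle U_x,U_x\rangle+a_5u^3\langle U,U\rangle+a_6u^2\langle U,U\rangle^2+a_7u\langle U,U\rangle^3+a_8\langle U,U\rangle^4,\\ U_{t_2}&=a_9U_{xx}+a_{10}u^3U+a_{11}u^2\langle U,U\rangle U+a_{12}u\langle U,U\rangle^2U+a_{13}\langle U,U\rangle^3U, \end{aligned}\tag{1} $$ with complex coefficients such that $(a_1,a_3,a_9)\ne 0$, $(a_3,\dots,a_8)\neq0$ and $(a_{10},a_{11},a_{12})\ne0$ (that is, the order is two, $U$ occurs in the first equation and $u$ in the second). Consider also the third-order system $$ \begin{aligned} u_{t_3}&=b_1u_{xxx}+b_2u^3u_x+b_3\langle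 U,U_{xxx}\rangle+b_4\langle U_x,U_{xx}\rangle+b_5u^2u_x\langle U,U\rangle+b_6u^3\langle U,U_x\rangle+b_7uu_x\langle U,U\rangle^2\\ &\quad+b_8u^2\langle U,U\rangle\langle U,U_x\rangle+b_9u_x\langle U,U\rangle^3+b_{10}u\langle U,U\rangle^2\langle U,U_x\rangle+b_{11}\langle U,U\rangle^3\langle U,U_x\rangle,\\ U_{t_3}&=b_{12}U_{xxx}+b_{13}u^2u_xU+b_{14}u^3U_x+b_{15}uu_x\langle U,U\rangle U+b_{16}u^2\langle U,U\rangle U_x+b_{17}u^2\langle U,U_x\rangle U+b_{18}u_x\langle U,U\rangle^2U\\ &\quad+b_{19}u\langle U,U\rangle^2U_x+b_{20}u\langle U,U\rangle\langle U,U_x\rangle U+b_{21}\langle U,U\rangle^3U_x+b_{22}\langle U,U\rangle^2\langle U,U_x\rangle U, \end{aligned}\tag{2} $$ with complex coefficients such that $(b_1,b_3,b_{12})\ne0$, $(b_1,\dots,b_{11})\neq0$ and $(b_{12},\dots,b_{22})\ne0$. The system (2) is called a symmetry of (1) if the two flows commute, i.e. $u_{t_2t_3}=u_{t_3t_2}$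 and $U_{t_2t_3}=U_{t_3t_2}$ hold identically as differential polynomials in $u$ and $U_1,\dots,U_N$ after all time derivatives are eliminated by means of (1) and (2). **Theorem.** If (1) has a symmetry of the form (2), then (1) coincides with the system $$ \begin{aligned} u_t&=u_{xx}+2\langle U,U_{xx}\rangle+2\langle U_x,U_x\rangle+2u\langle U,U\rangle^3+2\langle U,U\rangle^4,\\ U_t&=-u\langle U,U\rangle^2U-\langle U,U\rangle^3U \end{aligned} $$ up to a scaling of $t_2,x,u,U$ by nonzero complex constants. -/

import Mathlib

noncomputable section

namespace ScalarVector

/-- The jet variables of one scalar unknown `u` and one vector unknown `U = (U_1, …, U_N)`: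
`JetVar.u k` is `∂ₓᵏ u` and `JetVar.U j k` is `∂ₓᵏ U_j`. -/
inductive JetVar (N : ℕ) : Type
  | u (k : ℕ) : JetVar N
  | U (j : Fin N) (k : ℕ) : JetVar N

/-- Differential polynomials in `u` and `U_1, …, U_N` with complex coefficients. -/
abbrev DiffPoly (N : ℕ) : Type := MvPolynomial (JetVar N) ℂ

/-- The coordinate `∂ₓᵏ u`. -/
def du {N : ℕ} (k : ℕ) : DiffPoly N := MvPolynomial.X (JetVar.u k)

/-- The coordinate `∂ₓᵏ U_j`. -/
def dU {N : ℕ} (k : ℕ) (j : Fin N) : DiffPoly N := MvPolynomial.X (JetVar.U j k)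

/-- The scalar product `⟨∂ₓᵐ U, ∂ₓⁿ U⟩ = ∑ j, (∂ₓᵐ U_j) (∂ₓⁿ U_j)`. -/
def dot {N : ℕ} (m n : ℕ) : DiffPoly N := ∑ j : Fin N, dU m j * dU n j

/-- The total derivative with respect to `x`. -/
def totalDeriv (N : ℕ) : Derivation ℂ (DiffPoly N) (DiffPoly N) :=
  MvPolynomial.mkDerivation ℂ fun v =>
    match v with
    | JetVar.u k => du (k + 1)
    | JetVar.U j k => dU (k + 1) j

/-- An evolutionary system `u_t = F`, `(U_j)_t = G_j` with differential polynomial right-hand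
sides: `uRhs = F` and `URhs j = G_j`. -/
@[ext]
structure EvolutionSystem (N : ℕ) where
  uRhs : DiffPoly N
  URhs : Fin N → DiffPoly N

/-- The total derivative with respect to the time of the system `S`: the derivation on
differential polynomials in which time derivatives are replaced by the right-hand sides of `S`,
that is `∂ₓᵏ u ↦ ∂ₓᵏ F` and `∂ₓᵏ U_j ↦ ∂ₓᵏ G_j`. -/
def EvolutionSystem.timeDeriv {N : ℕ} (S : EvolutionSystem N) :
    Derivation ℂ (DiffPoly N) (DiffPoly N) :=
  MvPolynomial.mkDerivation ℂ fun v =>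
    match v with
    | JetVar.u k => (totalDeriv N)^[k] S.uRhs
    | JetVar.U j k => (totalDeriv N)^[k] (S.URhs j)

/-- `T` (with time `τ`) is a symmetry of `S` (with time `t`): the flows commute, that is
`u_{tτ} = u_{τt}` and `U_{tτ} = U_{τt}`. -/
def IsSymmetry {N : ℕ} (T S : EvolutionSystem N) : Prop :=
  T.timeDeriv S.uRhs = S.timeDeriv T.uRhs ∧
    ∀ j : Fin N, T.timeDeriv (S.URhs j) = S.timeDeriv (T.URhs j)

/-- The substitution `∂ₓᵏ u ↦ α ξ⁻ᵏ ∂ₓᵏ u`, `∂ₓᵏ U_j ↦ β ξ⁻ᵏ ∂ₓᵏ U_j` in differential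
polynomials, which is induced by replacing `(x, u, U)` by `(ξ x, α u, β U)`. -/
def scaleSubst (N : ℕ) (ξ α β : ℂ) : DiffPoly N →ₐ[ℂ] DiffPoly N :=
  MvPolynomial.aeval fun v =>
    match v with
    | JetVar.u k => MvPolynomial.C (α * (ξ ^ k)⁻¹) * du k
    | JetVar.U j k => MvPolynomial.C (β * (ξ ^ k)⁻¹) * dU k j

/-- The system obtained from `S` by writing `t = τ t'`, `x = ξ x'`, `u = α u'`, `U = β U'`
and expressing it in the primed variables: `α u'_{t'} = τ F(α u', …)`,
`β U'_{t'} = τ G(α u', …)`. -/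
def EvolutionSystem.rescale {N : ℕ} (S : EvolutionSystem N) (τ ξ α β : ℂ) : EvolutionSystem N where
  uRhs := MvPolynomial.C (τ * α⁻¹) * scaleSubst N ξ α β S.uRhs
  URhs j := MvPolynomial.C (τ * β⁻¹) * scaleSubst N ξ α β (S.URhs j)

/-- `S` coincides with `T` up to a scaling of `t`, `x`, `u`, `U`. -/
def EqUpToScaling {N : ℕ} (S T : EvolutionSystem N) : Prop :=
  ∃ τ ξ α β : ℂ, τ ≠ 0 ∧ ξ ≠ 0 ∧ α ≠ 0 ∧ β ≠ 0 ∧ S.rescale τ ξ α β = T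

/-- The coefficients of the general second-order ansatz. -/
structure Coeffs2 where
  (a1 a2 a3 a4 a5 a6 a7 a8 a9 a10 a11 a12 a13 : ℂ)

/-- The general homogeneous second-order system for the weights `λ₁ = 2/3`, `λ₂ = 1/3`. -/
def Coeffs2.system (a : Coeffs2) (N : ℕ) : EvolutionSystem N where
  uRhs := a.a1 • du 2 + a.a2 • du 0 ^ 4 + a.a3 • dot 0 2 + a.a4 • dot 1 1
    + a.a5 • (du 0 ^ 3 * dot 0 0) + a.a6 • (du 0 ^ 2 * dot 0 0 ^ 2)
    + a.a7 • (du 0 * dot 0 0 ^ 3) + a.a8 • dot 0 0 ^ 4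
  URhs j := a.a9 • dU 2 j + a.a10 • (du 0 ^ 3 * dU 0 j) + a.a11 • (du 0 ^ 2 * dot 0 0 * dU 0 j)
    + a.a12 • (du 0 * dot 0 0 ^ 2 * dU 0 j) + a.a13 • (dot 0 0 ^ 3 * dU 0 j)

/-- The order is two and the system is not triangular: `U` occurs in the equation for `u`,
and `u` occurs in the equation for `U`. -/
def Coeffs2.Admissible (a : Coeffs2) : Prop :=
  (a.a1, a.a3, a.a9) ≠ (0, 0, 0) ∧
  (a.a3, a.a4, a.a5, a.a6, a.a7, a.a8) ≠ (0, 0, 0, 0, 0, 0) ∧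
  (a.a10, a.a11, a.a12) ≠ (0, 0, 0)

/-- The coefficients of the general third-order ansatz. -/
structure Coeffs3 where
  (b1 b2 b3 b4 b5 b6 b7 b8 b9 b10 b11 b12 b13 b14 b15 b16 b17 b18 b19 b20 b21 b22 : ℂ)

/-- The general homogeneous third-order system for the weights `λ₁ = 2/3`, `λ₂ = 1/3`. -/
def Coeffs3.system (b : Coeffs3) (N : ℕ) : EvolutionSystem N where
  uRhs := b.b1 • du 3 + b.b2 • (du 0 ^ 3 * du 1) + b.b3 • dot 0 3
    + b.b4 • dot 1 2 + b.b5 • (du 0 ^ 2 * du 1 * dot 0 0)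
    + b.b6 • (du 0 ^ 3 * dot 0 1) + b.b7 • (du 0 * du 1 * dot 0 0 ^ 2)
    + b.b8 • (du 0 ^ 2 * dot 0 0 * dot 0 1)
    + b.b9 • (du 1 * dot 0 0 ^ 3)
    + b.b10 • (du 0 * dot 0 0 ^ 2 * dot 0 1)
    + b.b11 • (dot 0 0 ^ 3 * dot 0 1)
  URhs j := b.b12 • dU 3 j + b.b13 • (du 0 ^ 2 * du 1 * dU 0 j) + b.b14 • (du 0 ^ 3 * dU 1 j)
    + b.b15 • (du 0 * du 1 * dot 0 0 * dU 0 j)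
    + b.b16 • (du 0 ^ 2 * dot 0 0 * dU 1 j)
    + b.b17 • (du 0 ^ 2 * dot 0 1 * dU 0 j) + b.b18 • (du 1 * dot 0 0 ^ 2 * dU 0 j)
    + b.b19 • (du 0 * dot 0 0 ^ 2 * dU 1 j)
    + b.b20 • (du 0 * dot 0 0 * dot 0 1 * dU 0 j)
    + b.b21 • (dot 0 0 ^ 3 * dU 1 j)
    + b.b22 • (dot 0 0 ^ 2 * dot 0 1 * dU 0 j)

/-- The conditions on a third-order symmetry: the order is three, and neither of the two
right-hand sides is zero. (A symmetry may be triangular.) -/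
def Coeffs3.AdmissibleSymmetry (b : Coeffs3) : Prop :=
  (b.b1, b.b3, b.b12) ≠ (0, 0, 0) ∧
  ¬ (b.b1 = 0 ∧ b.b2 = 0 ∧ b.b3 = 0 ∧ b.b4 = 0 ∧ b.b5 = 0 ∧ b.b6 = 0 ∧ b.b7 = 0 ∧
      b.b8 = 0 ∧ b.b9 = 0 ∧ b.b10 = 0 ∧ b.b11 = 0) ∧
  ¬ (b.b12 = 0 ∧ b.b13 = 0 ∧ b.b14 = 0 ∧ b.b15 = 0 ∧ b.b16 = 0 ∧ b.b17 = 0 ∧ b.b18 = 0 ∧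
      b.b19 = 0 ∧ b.b20 = 0 ∧ b.b21 = 0 ∧ b.b22 = 0)

/-- The system
`u_t = u_xx + 2⟨U, U_xx⟩ + 2⟨U_x, U_x⟩ + 2u⟨U, U⟩³ + 2⟨U, U⟩⁴`,
`U_t = -u⟨U, U⟩² U - ⟨U, U⟩³ U`. -/
def targetSystem (N : ℕ) : EvolutionSystem N where
  uRhs := du 2 + 2 * dot 0 2 + 2 * dot 1 1 + 2 * du 0 * dot 0 0 ^ 3 + 2 * dot 0 0 ^ 4
  URhs j := -(du 0 * dot 0 0 ^ 2 * dU 0 j) - dot 0 0 ^ 3 * dU 0 j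

end ScalarVector

end

/-! Commutativity of the flows is an identity between differential polynomials, so each coefficient
of the commutator is a bilinear equation in the `a`'s and `b`'s. It is enough to test the identity
where a single component of `U` is nonzero: this loses the distinction between `⟨U, U⟩ U_x` and `⟨U,
U_x⟩ U`, but the remaining equations already determine (1). `IsSymmetry.uRhs_jetPoint` and
`IsSymmetry.URhs_jetPoint` carry out the expansion; `IsSymmetry.uRhs_coeffs` and
`IsSymmetry.URhs_coeffs` isolate the equations needed.

The elimination starts with the linear parts. Since `u` occurs in the second equation, `a9 ≠ 0`
would force `b1 = b3 = b12 = 0`, against the order of the symmetry; hence `a9 = 0`, then `b12 = 0`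
and `a1 ≠ 0`. The linear part of (2) is thereby tied to that of (1) by one nonzero ratio `k = b1 /
a1`. Next `a10 = a11 = 0`, so `a12 ≠ 0`, and the rest of the equations leave a family that
`Coeffs2.eqUpToScaling_targetSystem` rescales to the target. The target is a disguised heat
equation: `v = u + ⟨U, U⟩` satisfies `v_t = v_xx`, while `U_t = -⟨U, U⟩² v U`. -/

noncomputable section

namespace ScalarVector

/-! ### Evaluation and differentiation on jets with one nonzero component of `U`. -/

/-- The point of the jet space at which `∂ₓᵏ u = p k`, `∂ₓᵏ U_i = q k` and all other components
of `U` vanish. -/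
def jetPoint {N : ℕ} (i : Fin N) (p q : ℕ → ℂ) : JetVar N → ℂ
  | JetVar.u k => p k
  | JetVar.U j k => if j = i then q k else 0

variable {N : ℕ} (i : Fin N) (p q : ℕ → ℂ)

@[simp]
theorem eval_jetPoint_du (k : ℕ) : MvPolynomial.eval (jetPoint i p q) (du k) = p k := by
  simp [du, jetPoint]

@[simp]
theorem eval_jetPoint_dU (k : ℕ) : MvPolynomial.eval (jetPoint i p q) (dU k i) = q k := by
  simp [dU, jetPoint]

theorem eval_jetPoint_dU_mul (k : ℕ) (j : Fin N) (x : ℂ) :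
    MvPolynomial.eval (jetPoint i p q) (dU k j) * x = if j = i then q k * x else 0 := by
  simp [dU, jetPoint]

@[simp]
theorem eval_jetPoint_dot (m n : ℕ) :
    MvPolynomial.eval (jetPoint i p q) (dot m n) = q m * q n := by
  simp [dot, eval_jetPoint_dU_mul]

@[simp]
theorem totalDeriv_ofNat (n : ℕ) [n.AtLeastTwo] :
    totalDeriv N ofNat(n) = 0 :=
  (totalDeriv N).map_natCast n

@[simp]
theorem totalDeriv_du (k : ℕ) : totalDeriv N (du k) = du (k + 1) := by
  simp [totalDeriv, du]

@[simp]
theorem totalDeriv_dU (k : ℕ) (j : Fin N) : totalDeriv N (dU k j) = dU (k + 1) j := by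
  simp [totalDeriv, dU]

@[simp]
theorem totalDeriv_dot (m n : ℕ) :
    totalDeriv N (dot m n) = dot (m + 1) n + dot m (n + 1) := by
  simp only [dot, map_sum, Derivation.leibniz, totalDeriv_dU, smul_eq_mul, ← Finset.sum_add_distrib]
  exact Finset.sum_congr rfl fun j _ => by ring

namespace EvolutionSystem

variable (S : EvolutionSystem N)

@[simp]
theorem timeDeriv_du (k : ℕ) : S.timeDeriv (du k) = (totalDeriv N)^[k] S.uRhs := by
  simp [timeDeriv, du]

@[simp]
theorem timeDeriv_dU (k : ℕ) (j : Fin N) :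
    S.timeDeriv (dU k j) = (totalDeriv N)^[k] (S.URhs j) := by
  simp [timeDeriv, dU]

-- Each summand of the differentiated scalar product keeps an undifferentiated factor `∂ₓᵏ U_j`,
-- which vanishes at the point unless `j = i`; so only the `i`-th equation of the system matters.
@[simp]
theorem eval_jetPoint_timeDeriv_dot (m n : ℕ) :
    MvPolynomial.eval (jetPoint i p q) (S.timeDeriv (dot m n)) =
      q m * MvPolynomial.eval (jetPoint i p q) ((totalDeriv N)^[n] (S.URhs i)) +
        q n * MvPolynomial.eval (jetPoint i p q) ((totalDeriv N)^[m] (S.URhs i)) := by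
  simp [dot, eval_jetPoint_dU_mul, Finset.sum_add_distrib]

end EvolutionSystem

/-! ### The commutator on one-component jets. -/

-- Direct expansion, collected by monomials in `p` and `q`, all of weight 17/3. With one component,
-- `b16` and `b17` multiply the same monomial, as do `b19`, `b20` and `b21`, `b22`; only their sums
-- survive.
set_option maxHeartbeats 1000000 in
theorem IsSymmetry.uRhs_jetPoint (i : Fin N) (p q : ℕ → ℂ) {a : Coeffs2} {b : Coeffs3}
    (h : IsSymmetry (b.system N) (a.system N)) :
    (a.a1 * b.b3 + a.a3 * b.b12 - a.a3 * b.b1 - a.a9 * b.b3) * (q 0 * q 5)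
      + (8 * a.a8 * b.b18 - a.a8 * b.b7 - a.a12 * b.b11 - 6 * a.a13 * b.b9) * (q 0 ^ 12 * p 1)
      + (8 * a.a8 * (b.b21 + b.b22) + a.a7 * b.b11 - a.a8 * b.b10 - 8 * a.a8 * b.b9 - 14 * a.a13 *
        b.b11) * (q 0 ^ 13 * q 1)
      + (2 * a.a1 * b.b5 + 2 * a.a3 * b.b13 - 6 * a.a5 * b.b1 - 6 * a.a10 * b.b3) * (q 0 ^ 2 * p 1
        ^ 3)
      + (42 * a.a1 * b.b11 + 30 * a.a3 * (b.b21 + b.b22) + 12 * a.a4 * (b.b21 + b.b22) - a.a4 *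
        b.b10 - 42 * a.a13 * b.b4 - 210 * a.a13 * b.b3 - 336 * a.a8 * b.b1) * (q 0 ^ 5 * q 1 ^ 3)
      + (a.a3 * b.b18 - a.a12 * b.b3) * (q 0 ^ 6 * p 3)
      + (8 * a.a8 * b.b12 + a.a1 * b.b11 + a.a3 * (b.b21 + b.b22) + a.a7 * b.b3 - a.a3 * b.b9 -
        a.a9 * b.b11 - 8 * a.a8 * b.b1 - 8 * a.a13 * b.b3) * (q 0 ^ 7 * q 3)
      + (2 * a.a1 * b.b3 + 2 * a.a4 * b.b12 + a.a1 * b.b4 - a.a9 * b.b4 - 2 * a.a4 * b.b1 - 3 *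
        a.a3 * b.b1) * (q 1 * q 4)
      + (3 * a.a1 * b.b4 + a.a1 * b.b3 + a.a3 * b.b12 - a.a9 * b.b3 - a.a9 * b.b4 - 4 * a.a3 *
        b.b1 - 6 * a.a4 * b.b1) * (q 2 * q 3)
      + (6 * a.a1 * b.b2 - 24 * a.a2 * b.b1) * (p 0 * p 1 ^ 3)
      + (-3 * a.a2 * b.b2) * (p 0 ^ 6 * p 1)
      + (2 * a.a5 * b.b14 + a.a2 * b.b6 - 2 * a.a5 * b.b2 - 2 * a.a10 * b.b6) * (q 0 * q 1 * p 0 ^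
        6)
      + (6 * a.a1 * b.b8 + 4 * a.a4 * (b.b16 + b.b17) + 2 * a.a3 * (b.b16 + b.b17) - 3 * a.a4 *
        b.b6 - 6 * a.a11 * b.b3 - 6 * a.a11 * b.b4 - 24 * a.a6 * b.b1) * (q 0 * q 1 ^ 3 * p 0 ^ 2)
      + (4 * a.a2 * b.b3 + 2 * a.a5 * b.b12 + a.a1 * b.b6 + a.a3 * b.b14 - a.a3 * b.b2 - a.a9 *
        b.b6 - 2 * a.a5 * b.b1 - 2 * a.a10 * b.b3) * (q 0 * q 3 * p 0 ^ 3)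
      + (8 * a.a8 * b.b15 + 6 * a.a7 * b.b18 - a.a7 * b.b7 - a.a12 * b.b10 - 2 * a.a8 * b.b5 - 2 *
        a.a11 * b.b11 - 4 * a.a13 * b.b7 - 6 * a.a12 * b.b9) * (q 0 ^ 10 * p 0 * p 1)
      + (8 * a.a8 * (b.b19 + b.b20) + 6 * a.a7 * (b.b21 + b.b22) + 2 * a.a6 * b.b11 - 2 * a.a8 *
        b.b8 - 6 * a.a7 * b.b9 - 8 * a.a8 * b.b7 - 12 * a.a13 * b.b10 - 12 * a.a12 * b.b11) * (q 0
        ^ 11 * q 1 * p 0)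
      + (a.a3 * b.b13 - 3 * a.a10 * b.b3) * (q 0 ^ 2 * p 0 ^ 2 * p 3)
      + (2 * a.a5 * b.b13 - 2 * a.a2 * b.b5 - 2 * a.a10 * b.b5 - 3 * a.a5 * b.b2 - 3 * a.a10 *
        b.b6) * (q 0 ^ 2 * p 0 ^ 5 * p 1)
      + (4 * a.a6 * b.b14 + 2 * a.a2 * b.b8 + 2 * a.a5 * (b.b16 + b.b17) - 2 * a.a5 * b.b5 - 4 *
        a.a6 * b.b2 - 4 * a.a11 * b.b6 - 4 * a.a10 * b.b8) * (q 0 ^ 3 * q 1 * p 0 ^ 5)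
      + (8 * a.a1 * b.b7 + 6 * a.a3 * b.b15 + 2 * a.a1 * b.b8 + 2 * a.a3 * (b.b16 + b.b17) + 2 *
        a.a4 * b.b15 - 2 * a.a11 * b.b4 - 18 * a.a11 * b.b3 - 24 * a.a6 * b.b1) * (q 0 ^ 3 * q 1 *
        p 1 ^ 2)
      + (20 * a.a1 * b.b10 + 12 * a.a3 * (b.b19 + b.b20) + 8 * a.a4 * (b.b19 + b.b20) - 2 * a.a4 *
        b.b8 - 20 * a.a12 * b.b4 - 60 * a.a12 * b.b3 - 120 * a.a7 * b.b1) * (q 0 ^ 3 * q 1 ^ 3 * p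
        0)
      + (4 * a.a6 * b.b12 + 3 * a.a5 * b.b3 + a.a1 * b.b8 + a.a3 * (b.b16 + b.b17) - a.a3 * b.b5 -
        a.a9 * b.b8 - 4 * a.a6 * b.b1 - 4 * a.a11 * b.b3) * (q 0 ^ 3 * q 3 * p 0 ^ 2)
      + (30 * a.a1 * b.b9 + 20 * a.a3 * b.b18 + 10 * a.a1 * b.b10 + 10 * a.a4 * b.b18 + 8 * a.a3 *
        (b.b19 + b.b20) + 2 * a.a4 * (b.b19 + b.b20) - a.a4 * b.b7 - 10 * a.a12 * b.b4 - 60 *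
        a.a12 * b.b3 - 90 * a.a7 * b.b1) * (q 0 ^ 4 * q 1 ^ 2 * p 1)
      + (a.a3 * b.b15 - 2 * a.a11 * b.b3) * (q 0 ^ 4 * p 0 * p 3)
      + (4 * a.a6 * b.b13 + 2 * a.a5 * b.b15 - a.a2 * b.b7 - 2 * a.a5 * b.b5 - 2 * a.a11 * b.b5 -
        2 * a.a11 * b.b6 - 3 * a.a6 * b.b2 - 3 * a.a10 * b.b8 - 4 * a.a10 * b.b7) * (q 0 ^ 4 * p 0
        ^ 4 * p 1)
      + (3 * a.a3 * b.b15 + 2 * a.a1 * b.b7 - 6 * a.a6 * b.b1 - 6 * a.a11 * b.b3) * (q 0 ^ 4 * p 1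
        * p 2)
      + (6 * a.a7 * b.b14 + 4 * a.a6 * (b.b16 + b.b17) + 3 * a.a2 * b.b10 + 2 * a.a5 * (b.b19 +
        b.b20) + a.a5 * b.b8 - a.a6 * b.b6 - 2 * a.a5 * b.b7 - 4 * a.a6 * b.b5 - 6 * a.a7 * b.b2 -
        6 * a.a12 * b.b6 - 6 * a.a11 * b.b8 - 6 * a.a10 * b.b10) * (q 0 ^ 5 * q 1 * p 0 ^ 4)
      + (12 * a.a1 * b.b9 + 10 * a.a3 * b.b18 + 2 * a.a4 * b.b18 + a.a3 * (b.b19 + b.b20) - a.a12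
        * b.b4 - 15 * a.a12 * b.b3 - 18 * a.a7 * b.b1) * (q 0 ^ 5 * q 1 * p 2)
      + (6 * a.a1 * b.b9 + 6 * a.a3 * b.b18 + 2 * a.a1 * b.b10 + 2 * a.a3 * (b.b19 + b.b20) -
        a.a12 * b.b4 - a.a3 * b.b7 - 6 * a.a9 * b.b9 - 15 * a.a12 * b.b3 - 18 * a.a7 * b.b1) * (q
        0 ^ 5 * q 2 * p 1)
      + (6 * a.a7 * b.b12 + 2 * a.a6 * b.b3 + a.a1 * b.b10 + a.a3 * (b.b19 + b.b20) - a.a3 * b.b7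
        - a.a9 * b.b10 - 6 * a.a7 * b.b1 - 6 * a.a12 * b.b3) * (q 0 ^ 5 * q 3 * p 0)
      + (21 * a.a1 * b.b11 + 19 * a.a3 * (b.b21 + b.b22) + 2 * a.a4 * (b.b21 + b.b22) + a.a7 *
        b.b4 - a.a3 * b.b9 - a.a3 * b.b10 - 2 * a.a4 * b.b9 - 7 * a.a9 * b.b11 - 14 * a.a13 * b.b4
        - 126 * a.a13 * b.b3 - 168 * a.a8 * b.b1) * (q 0 ^ 6 * q 1 * q 2)
      + (6 * a.a7 * b.b13 + 4 * a.a6 * b.b15 + 2 * a.a5 * b.b18 - a.a5 * b.b7 - a.a12 * b.b6 - 2 *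
        a.a6 * b.b5 - 2 * a.a12 * b.b5 - 2 * a.a11 * b.b8 - 3 * a.a7 * b.b2 - 3 * a.a10 * b.b10 -
        4 * a.a11 * b.b7 - 6 * a.a10 * b.b9) * (q 0 ^ 6 * p 0 ^ 3 * p 1)
      + (8 * a.a8 * b.b14 + 6 * a.a7 * (b.b16 + b.b17) + 4 * a.a2 * b.b11 + 4 * a.a6 * (b.b19 +
        b.b20) + 2 * a.a5 * (b.b21 + b.b22) + 2 * a.a5 * b.b10 - 2 * a.a7 * b.b6 - 2 * a.a5 * b.b9
        - 4 * a.a6 * b.b7 - 6 * a.a7 * b.b5 - 8 * a.a8 * b.b2 - 8 * a.a13 * b.b6 - 8 * a.a12 *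
        b.b8 - 8 * a.a11 * b.b10 - 8 * a.a10 * b.b11) * (q 0 ^ 7 * q 1 * p 0 ^ 3)
      + (8 * a.a8 * b.b13 + 6 * a.a7 * b.b15 + 4 * a.a6 * b.b18 - a.a6 * b.b7 - a.a12 * b.b8 - 2 *
        a.a7 * b.b5 - 2 * a.a13 * b.b5 - 2 * a.a11 * b.b10 - 3 * a.a8 * b.b2 - 3 * a.a10 * b.b11 -
        4 * a.a12 * b.b7 - 6 * a.a11 * b.b9) * (q 0 ^ 8 * p 0 ^ 2 * p 1)
      + (8 * a.a8 * (b.b16 + b.b17) + 6 * a.a7 * (b.b19 + b.b20) + 4 * a.a6 * (b.b21 + b.b22) + 3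
        * a.a5 * b.b11 + a.a6 * b.b10 - a.a7 * b.b8 - 3 * a.a8 * b.b6 - 4 * a.a6 * b.b9 - 6 * a.a7
        * b.b7 - 8 * a.a8 * b.b5 - 10 * a.a13 * b.b8 - 10 * a.a12 * b.b10 - 10 * a.a11 * b.b11) *
        (q 0 ^ 9 * q 1 * p 0 ^ 2)
      + (4 * a.a2 * b.b4 + 3 * a.a1 * b.b6 + 2 * a.a4 * b.b14 + a.a3 * b.b14 - a.a3 * b.b2 - a.a9
        * b.b6 - 2 * a.a4 * b.b2 - 2 * a.a10 * b.b4 - 6 * a.a5 * b.b1) * (q 1 * q 2 * p 0 ^ 3)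
      + (6 * a.a1 * b.b6 + 6 * a.a4 * b.b14 + 2 * a.a1 * b.b5 + 2 * a.a4 * b.b13 - 3 * a.a4 * b.b2
        - 6 * a.a10 * b.b4 - 18 * a.a5 * b.b1) * (q 1 ^ 2 * p 0 ^ 2 * p 1)
      + (6 * a.a1 * b.b2 - 36 * a.a2 * b.b1) * (p 0 ^ 2 * p 1 * p 2)
      + (8 * a.a1 * b.b5 + 6 * a.a1 * b.b6 + 6 * a.a3 * b.b14 + 4 * a.a3 * b.b13 + 4 * a.a4 *
        b.b13 - 6 * a.a10 * b.b4 - 18 * a.a10 * b.b3 - 36 * a.a5 * b.b1) * (q 0 * q 1 * p 0 * p 1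
        ^ 2)
      + (4 * a.a1 * b.b5 + 3 * a.a3 * b.b14 + 2 * a.a3 * b.b13 + 2 * a.a4 * b.b13 - 3 * a.a10 *
        b.b4 - 9 * a.a10 * b.b3 - 18 * a.a5 * b.b1) * (q 0 * q 1 * p 0 ^ 2 * p 2)
      + (6 * a.a1 * b.b6 + 6 * a.a3 * b.b14 + 2 * a.a1 * b.b5 + 2 * a.a3 * b.b13 - 2 * a.a9 * b.b5
        - 3 * a.a3 * b.b2 - 3 * a.a10 * b.b4 - 9 * a.a10 * b.b3 - 18 * a.a5 * b.b1) * (q 0 * q 2 *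
        p 0 ^ 2 * p 1)
      + (9 * a.a1 * b.b8 + 7 * a.a3 * (b.b16 + b.b17) + 3 * a.a5 * b.b4 + 2 * a.a4 * (b.b16 +
        b.b17) - a.a3 * b.b5 - 2 * a.a4 * b.b5 - 3 * a.a3 * b.b6 - 3 * a.a9 * b.b8 - 6 * a.a11 *
        b.b4 - 18 * a.a11 * b.b3 - 36 * a.a6 * b.b1) * (q 0 ^ 2 * q 1 * q 2 * p 0 ^ 2)
      + (12 * a.a1 * b.b7 + 12 * a.a1 * b.b8 + 8 * a.a3 * (b.b16 + b.b17) + 6 * a.a3 * b.b15 + 6 *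
        a.a4 * b.b15 + 4 * a.a4 * (b.b16 + b.b17) - 2 * a.a4 * b.b5 - 12 * a.a11 * b.b4 - 36 *
        a.a11 * b.b3 - 72 * a.a6 * b.b1) * (q 0 ^ 2 * q 1 ^ 2 * p 0 * p 1)
      + (6 * a.a3 * b.b13 + 4 * a.a1 * b.b5 - 18 * a.a5 * b.b1 - 18 * a.a10 * b.b3) * (q 0 ^ 2 * p
        0 * p 1 * p 2)
      + (8 * a.a1 * b.b7 + 6 * a.a3 * b.b15 + 2 * a.a3 * (b.b16 + b.b17) + 2 * a.a4 * b.b15 - 2 *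
        a.a11 * b.b4 - 18 * a.a11 * b.b3 - 24 * a.a6 * b.b1) * (q 0 ^ 3 * q 1 * p 0 * p 2)
      + (4 * a.a1 * b.b7 + 4 * a.a1 * b.b8 + 4 * a.a3 * b.b15 + 4 * a.a3 * (b.b16 + b.b17) - 2 *
        a.a11 * b.b4 - 2 * a.a3 * b.b5 - 4 * a.a9 * b.b7 - 18 * a.a11 * b.b3 - 24 * a.a6 * b.b1) *
        (q 0 ^ 3 * q 2 * p 0 * p 1)
      + (15 * a.a1 * b.b10 + 13 * a.a3 * (b.b19 + b.b20) + 2 * a.a4 * (b.b19 + b.b20) + 2 * a.a6 *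
        b.b4 - a.a3 * b.b7 - 2 * a.a4 * b.b7 - 2 * a.a3 * b.b8 - 5 * a.a9 * b.b10 - 10 * a.a12 *
        b.b4 - 60 * a.a12 * b.b3 - 90 * a.a7 * b.b1) * (q 0 ^ 4 * q 1 * q 2 * p 0) = 0 := by
  have h := congrArg (MvPolynomial.eval (jetPoint i p q)) h.1
  simp [Coeffs2.system, Coeffs3.system, Derivation.leibniz, Derivation.leibniz_pow,
    Function.iterate_succ_apply'] at h
  linear_combination h

set_option maxHeartbeats 1000000 in
theorem IsSymmetry.URhs_jetPoint (i : Fin N) (p q : ℕ → ℂ) {a : Coeffs2} {b : Coeffs3}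
    (h : IsSymmetry (b.system N) (a.system N)) :
    (2 * a.a9 * b.b13 - 6 * a.a10 * b.b12) * (q 0 * p 1 ^ 3)
      + (2 * a.a13 * b.b18 + a.a12 * b.b9 - a.a8 * b.b15 - a.a7 * b.b18 - a.a12 * (b.b21 + b.b22))
        * (q 0 ^ 11 * p 1)
      + (a.a12 * b.b11 - a.a8 * (b.b19 + b.b20) - 6 * a.a13 * (b.b21 + b.b22) - 8 * a.a8 * b.b18)
        * (q 0 ^ 12 * q 1)
      + (30 * a.a9 * (b.b21 + b.b22) - a.a4 * (b.b19 + b.b20) - 210 * a.a13 * b.b12) * (q 0 ^ 4 *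
        q 1 ^ 3)
      + (a.a9 * b.b18 + a.a12 * b.b1 - a.a12 * b.b12 - a.a1 * b.b18) * (q 0 ^ 5 * p 3)
      + (a.a12 * b.b3 - a.a3 * b.b18) * (q 0 ^ 6 * q 3)
      + (-3 * a.a2 * b.b14) * (q 1 * p 0 ^ 6)
      + (2 * a.a9 * (b.b16 + b.b17) - 3 * a.a4 * b.b14 - 6 * a.a11 * b.b12) * (q 1 ^ 3 * p 0 ^ 2)
      + (3 * a.a10 * b.b1 + a.a9 * b.b13 - a.a1 * b.b13 - 3 * a.a10 * b.b12) * (q 0 * p 0 ^ 2 * p 3)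
      + (3 * a.a10 * b.b2 - 3 * a.a10 * b.b14 - 6 * a.a2 * b.b13) * (q 0 * p 0 ^ 5 * p 1)
      + (2 * a.a11 * b.b11 + a.a12 * b.b10 - a.a7 * (b.b19 + b.b20) - 2 * a.a8 * (b.b16 + b.b17) -
        4 * a.a13 * (b.b19 + b.b20) - 6 * a.a12 * (b.b21 + b.b22) - 6 * a.a7 * b.b18 - 8 * a.a8 *
        b.b15) * (q 0 ^ 10 * q 1 * p 0)
      + (3 * a.a10 * b.b6 - 2 * a.a10 * (b.b16 + b.b17) - 2 * a.a5 * b.b13 - 2 * a.a2 * (b.b16 +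
        b.b17) - 3 * a.a5 * b.b14) * (q 0 ^ 2 * q 1 * p 0 ^ 5)
      + (6 * a.a9 * b.b15 + 2 * a.a9 * (b.b16 + b.b17) - 18 * a.a11 * b.b12) * (q 0 ^ 2 * q 1 * p
        1 ^ 2)
      + (12 * a.a9 * (b.b19 + b.b20) - 2 * a.a4 * (b.b16 + b.b17) - 60 * a.a12 * b.b12) * (q 0 ^ 2
        * q 1 ^ 3 * p 0)
      + (3 * a.a10 * b.b3 - a.a3 * b.b13) * (q 0 ^ 2 * q 3 * p 0 ^ 2)
      + (20 * a.a9 * b.b18 + 8 * a.a9 * (b.b19 + b.b20) - a.a4 * b.b15 - 60 * a.a12 * b.b12) * (q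
        0 ^ 3 * q 1 ^ 2 * p 1)
      + (2 * a.a11 * b.b1 + a.a9 * b.b15 - a.a1 * b.b15 - 2 * a.a11 * b.b12) * (q 0 ^ 3 * p 0 * p 3)
      + (3 * a.a10 * b.b5 + 2 * a.a11 * b.b13 + 2 * a.a11 * b.b2 - 2 * a.a10 * b.b15 - 2 * a.a11 *
        b.b14 - 3 * a.a10 * (b.b16 + b.b17) - 5 * a.a5 * b.b13 - 5 * a.a2 * b.b15) * (q 0 ^ 3 * p
        0 ^ 4 * p 1)
      + (3 * a.a9 * b.b15 - a.a1 * b.b15 - 6 * a.a11 * b.b12) * (q 0 ^ 3 * p 1 * p 2)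
      + (3 * a.a10 * b.b8 + 2 * a.a11 * b.b6 - a.a2 * (b.b19 + b.b20) - 2 * a.a11 * (b.b16 +
        b.b17) - 2 * a.a5 * b.b15 - 2 * a.a5 * (b.b16 + b.b17) - 3 * a.a6 * b.b14 - 4 * a.a10 *
        (b.b19 + b.b20) - 4 * a.a6 * b.b13) * (q 0 ^ 4 * q 1 * p 0 ^ 4)
      + (10 * a.a9 * b.b18 + a.a9 * (b.b19 + b.b20) - a.a1 * (b.b19 + b.b20) - 15 * a.a12 * b.b12)
        * (q 0 ^ 4 * q 1 * p 2)
      + (2 * a.a9 * (b.b19 + b.b20) - a.a3 * b.b15 - 15 * a.a12 * b.b12) * (q 0 ^ 4 * q 2 * p 1)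
      + (2 * a.a11 * b.b3 - a.a3 * b.b15) * (q 0 ^ 4 * q 3 * p 0)
      + (12 * a.a9 * (b.b21 + b.b22) + a.a12 * b.b4 - a.a3 * b.b18 - a.a3 * (b.b19 + b.b20) - 2 *
        a.a4 * b.b18 - 126 * a.a13 * b.b12) * (q 0 ^ 5 * q 1 * q 2)
      + (4 * a.a12 * b.b13 + 3 * a.a10 * b.b7 + 2 * a.a11 * b.b5 + a.a12 * b.b2 - a.a12 * b.b14 -
        2 * a.a11 * (b.b16 + b.b17) - 3 * a.a10 * (b.b19 + b.b20) - 4 * a.a10 * b.b18 - 4 * a.a6 *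
        b.b13 - 4 * a.a5 * b.b15 - 4 * a.a2 * b.b18) * (q 0 ^ 5 * p 0 ^ 3 * p 1)
      + (3 * a.a10 * b.b10 + 2 * a.a11 * b.b8 + a.a12 * b.b6 - a.a5 * (b.b19 + b.b20) - 2 * a.a12
        * (b.b16 + b.b17) - 2 * a.a6 * (b.b16 + b.b17) - 2 * a.a5 * b.b18 - 3 * a.a7 * b.b14 - 4 *
        a.a11 * (b.b19 + b.b20) - 4 * a.a6 * b.b15 - 6 * a.a10 * (b.b21 + b.b22) - 6 * a.a7 *
        b.b13) * (q 0 ^ 6 * q 1 * p 0 ^ 3)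
      + (6 * a.a13 * b.b13 + 3 * a.a10 * b.b9 + 2 * a.a11 * b.b7 + 2 * a.a12 * b.b15 + a.a12 *
        b.b5 - a.a12 * (b.b16 + b.b17) - 2 * a.a11 * b.b18 - 2 * a.a11 * (b.b19 + b.b20) - 3 *
        a.a7 * b.b13 - 3 * a.a6 * b.b15 - 3 * a.a5 * b.b18 - 3 * a.a10 * (b.b21 + b.b22)) * (q 0 ^
        7 * p 0 ^ 2 * p 1)
      + (3 * a.a10 * b.b11 + 2 * a.a11 * b.b10 + a.a12 * b.b8 - a.a6 * (b.b19 + b.b20) - 2 * a.a13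
        * (b.b16 + b.b17) - 2 * a.a7 * (b.b16 + b.b17) - 3 * a.a8 * b.b14 - 4 * a.a12 * (b.b19 +
        b.b20) - 4 * a.a6 * b.b18 - 6 * a.a11 * (b.b21 + b.b22) - 6 * a.a7 * b.b15 - 8 * a.a8 *
        b.b13) * (q 0 ^ 8 * q 1 * p 0 ^ 2)
      + (4 * a.a13 * b.b15 + 2 * a.a11 * b.b9 + a.a12 * b.b7 - a.a12 * (b.b19 + b.b20) - 2 * a.a8
        * b.b13 - 2 * a.a7 * b.b15 - 2 * a.a6 * b.b18 - 2 * a.a11 * (b.b21 + b.b22)) * (q 0 ^ 9 *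
        p 0 * p 1)
      + (6 * a.a9 * b.b14 + 4 * a.a9 * b.b13 - 18 * a.a10 * b.b12) * (q 1 * p 0 * p 1 ^ 2)
      + (3 * a.a9 * b.b14 + 2 * a.a9 * b.b13 - 3 * a.a1 * b.b14 - 9 * a.a10 * b.b12) * (q 1 * p 0
        ^ 2 * p 2)
      + (6 * a.a9 * b.b14 - 9 * a.a10 * b.b12) * (q 2 * p 0 ^ 2 * p 1)
      + (4 * a.a9 * (b.b16 + b.b17) + 3 * a.a10 * b.b4 - a.a3 * b.b13 - 2 * a.a4 * b.b13 - 3 *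
        a.a3 * b.b14 - 18 * a.a11 * b.b12) * (q 0 * q 1 * q 2 * p 0 ^ 2)
      + (8 * a.a9 * (b.b16 + b.b17) + 6 * a.a9 * b.b15 - 2 * a.a4 * b.b13 - 36 * a.a11 * b.b12) *
        (q 0 * q 1 ^ 2 * p 0 * p 1)
      + (6 * a.a9 * b.b13 - 2 * a.a1 * b.b13 - 18 * a.a10 * b.b12) * (q 0 * p 0 * p 1 * p 2)
      + (6 * a.a9 * b.b15 + 2 * a.a9 * (b.b16 + b.b17) - 2 * a.a1 * (b.b16 + b.b17) - 18 * a.a11 *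
        b.b12) * (q 0 ^ 2 * q 1 * p 0 * p 2)
      + (4 * a.a9 * (b.b16 + b.b17) - 2 * a.a3 * b.b13 - 18 * a.a11 * b.b12) * (q 0 ^ 2 * q 2 * p
        0 * p 1)
      + (8 * a.a9 * (b.b19 + b.b20) + 2 * a.a11 * b.b4 - a.a3 * b.b15 - 2 * a.a4 * b.b15 - 2 *
        a.a3 * (b.b16 + b.b17) - 60 * a.a12 * b.b12) * (q 0 ^ 3 * q 1 * q 2 * p 0) = 0 := by
  have h := congrArg (MvPolynomial.eval (jetPoint i p q)) (h.2 i)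
  simp [Coeffs2.system, Coeffs3.system, Derivation.leibniz, Derivation.leibniz_pow,
    Function.iterate_succ_apply'] at h
  linear_combination h

/-! ### Extraction of single coefficients. -/

set_option maxHeartbeats 2000000 in
/-- Some of the coefficients of `u_{t₂t₃} - u_{t₃t₂}`. -/
theorem IsSymmetry.uRhs_coeffs (i : Fin N) {a : Coeffs2} {b : Coeffs3}
    (hab : IsSymmetry (b.system N) (a.system N)) :
    6 * a.a1 * b.b2 - 36 * a.a2 * b.b1 = 0 ∧
    6 * a.a1 * b.b2 - 24 * a.a2 * b.b1 = 0 ∧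
    6 * a.a3 * b.b13 + 4 * a.a1 * b.b5 - 18 * a.a5 * b.b1 - 18 * a.a10 * b.b3 = 0 ∧
    2 * a.a1 * b.b5 + 2 * a.a3 * b.b13 - 6 * a.a5 * b.b1 - 6 * a.a10 * b.b3 = 0 ∧
    3 * a.a3 * b.b15 + 2 * a.a1 * b.b7 - 6 * a.a6 * b.b1 - 6 * a.a11 * b.b3 = 0 ∧
    8 * a.a1 * b.b7 + 6 * a.a3 * b.b15 + 2 * a.a1 * b.b8 + 2 * a.a3 * (b.b16 + b.b17) + 2 * a.a4 *
      b.b15 - 2 * a.a11 * b.b4 - 18 * a.a11 * b.b3 - 24 * a.a6 * b.b1 = 0 ∧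
    4 * a.a1 * b.b7 + 4 * a.a1 * b.b8 + 4 * a.a3 * b.b15 + 4 * a.a3 * (b.b16 + b.b17) - 2 * a.a11
      * b.b4 - 2 * a.a3 * b.b5 - 4 * a.a9 * b.b7 - 18 * a.a11 * b.b3 - 24 * a.a6 * b.b1 = 0 ∧
    6 * a.a7 * b.b12 + 2 * a.a6 * b.b3 + a.a1 * b.b10 + a.a3 * (b.b19 + b.b20) - a.a3 * b.b7 -
      a.a9 * b.b10 - 6 * a.a7 * b.b1 - 6 * a.a12 * b.b3 = 0 ∧
    6 * a.a1 * b.b9 + 6 * a.a3 * b.b18 + 2 * a.a1 * b.b10 + 2 * a.a3 * (b.b19 + b.b20) - a.a12 *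
      b.b4 - a.a3 * b.b7 - 6 * a.a9 * b.b9 - 15 * a.a12 * b.b3 - 18 * a.a7 * b.b1 = 0 ∧
    15 * a.a1 * b.b10 + 13 * a.a3 * (b.b19 + b.b20) + 2 * a.a4 * (b.b19 + b.b20) + 2 * a.a6 * b.b4
      - a.a3 * b.b7 - 2 * a.a4 * b.b7 - 2 * a.a3 * b.b8 - 5 * a.a9 * b.b10 - 10 * a.a12 * b.b4 -
      60 * a.a12 * b.b3 - 90 * a.a7 * b.b1 = 0 ∧
    12 * a.a1 * b.b9 + 10 * a.a3 * b.b18 + 2 * a.a4 * b.b18 + a.a3 * (b.b19 + b.b20) - a.a12 *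
      b.b4 - 15 * a.a12 * b.b3 - 18 * a.a7 * b.b1 = 0 ∧
    8 * a.a8 * (b.b19 + b.b20) + 6 * a.a7 * (b.b21 + b.b22) + 2 * a.a6 * b.b11 - 2 * a.a8 * b.b8 -
      6 * a.a7 * b.b9 - 8 * a.a8 * b.b7 - 12 * a.a13 * b.b10 - 12 * a.a12 * b.b11 = 0 := by
  -- Values of `u, …, u_xxx` and of the `i`-th component and its derivatives; higher jets are set to
  -- zero. At such sparse points few monomials survive, and they are separated by parity (sign
  -- changes) or by degree (doubling a coordinate).
  have h (x0 x1 x2 x3 y0 y1 y2 y3 : ℂ) := hab.uRhs_jetPoint i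
    (fun | 0 => x0 | 1 => x1 | 2 => x2 | 3 => x3 | _ => 0)
    (fun | 0 => y0 | 1 => y1 | 2 => y2 | 3 => y3 | _ => 0)
  simp only at h
  refine ⟨?_, ?_, ?_, ?_, ?_, ?_, ?_, ?_, ?_, ?_, ?_, ?_⟩
  · linear_combination (-1) * h 1 1 0 0 0 0 0 0 + h 1 1 1 0 0 0 0 0
  · linear_combination (1/2) * h 1 1 0 0 0 0 0 0 + (-1/2) * h (-1) 1 0 0 0 0 0 0
  · linear_combination h 0 1 0 0 1 0 0 0 + h 1 1 0 0 0 0 0 0 + (-1) * h 1 1 0 0 1 0 0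
      0 + (-1) * h 0 1 1 0 1 0 0 0 + (-1) * h 1 1 1 0 0 0 0 0 + h 1 1 1 0 1 0 0 0
  -- With `p 1 = 1`, only `q 0 ^ 2 * p 1 ^ 3` and `q 0 ^ 12 * p 1` survive; the values at `q 0 = 1,
  -- 2` give a 2×2 system with 4096 - 4 = 4092 = 4 · 1023.
  · linear_combination (1024/1023) * h 0 1 0 0 1 0 0 0 + (-1/4092) * h 0 1 0 0 2 0 0 0
  · linear_combination (-1) * h 0 1 0 0 1 0 0 0 + h 0 1 1 0 1 0 0 0
  · linear_combination (-1) * h 0 0 0 0 1 1 0 0 + (1/2) * h 0 1 0 0 1 1 0 0 + (1/2) * h 0 (-1) 0 0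
      1 1 0 0
  · linear_combination (-1/2) * h 1 1 0 0 1 0 0 0 + (1/2) * h (-1) 1 0 0 1 0 0 0 + (1/2) * h 1 1 0
      0 1 0 1 0 + (-1/2) * h (-1) 1 0 0 1 0 1 0
  · linear_combination (-4) * h 0 0 0 0 1 0 0 1 + (-1/6) * h 1 0 0 0 1 0 0 1 + (-1/10) * h (-1) 0
      0 0 1 0 0 1 + (1/30) * h 1 0 0 0 2 0 0 1
  · linear_combination (-1) * h 0 1 0 0 1 0 0 0 + h 0 1 0 0 1 0 1 0
  · linear_combination (-1/2) * h 1 0 0 0 1 1 0 0 + (1/2) * h (-1) 0 0 0 1 1 0 0 + (-1) * h 1 0 0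
      0 0 1 1 0 + (1/2) * h 1 0 0 0 1 1 1 0 + (-1/2) * h (-1) 0 0 0 1 1 1 0
  · linear_combination (-1) * h 0 0 0 0 1 1 0 0 + h 0 0 1 0 1 1 0 0
  -- The part odd in `p 0` has four monomials in `p 0, q 0, q 1`. Four differences under `p 0 ↦ -p
  -- 0` determine them: one at ones, and one with each of `q 0`, `q 1`, `p 0` doubled.
  · linear_combination (-109/1890) * h 1 0 0 0 1 1 0 0 + (109/1890) * h (-1) 0 0 0 1 1 0 0 +
      (1/3780) * h 1 0 0 0 2 1 0 0 + (-1/3780) * h (-1) 0 0 0 2 1 0 0 + (5/756) * h 1 0 0 0 1 2 0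
      0 + (-5/756) * h (-1) 0 0 0 1 2 0 0 + (1/756) * h 2 0 0 0 1 1 0 0 + (-1/756) * h (-2) 0 0 0
      1 1 0 0

set_option maxHeartbeats 2000000 in
/-- Some of the coefficients of `U_{t₂t₃} - U_{t₃t₂}`. -/
theorem IsSymmetry.URhs_coeffs (i : Fin N) {a : Coeffs2} {b : Coeffs3}
    (hab : IsSymmetry (b.system N) (a.system N)) :
    3 * a.a10 * b.b3 - a.a3 * b.b13 = 0 ∧
    2 * a.a11 * b.b3 - a.a3 * b.b15 = 0 ∧
    a.a12 * b.b3 - a.a3 * b.b18 = 0 ∧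
    3 * a.a10 * b.b1 + a.a9 * b.b13 - a.a1 * b.b13 - 3 * a.a10 * b.b12 = 0 ∧
    2 * a.a11 * b.b1 + a.a9 * b.b15 - a.a1 * b.b15 - 2 * a.a11 * b.b12 = 0 ∧
    a.a9 * b.b18 + a.a12 * b.b1 - a.a12 * b.b12 - a.a1 * b.b18 = 0 ∧
    2 * a.a9 * b.b13 - 6 * a.a10 * b.b12 = 0 ∧
    6 * a.a9 * b.b14 - 9 * a.a10 * b.b12 = 0 ∧
    6 * a.a9 * b.b14 + 4 * a.a9 * b.b13 - 18 * a.a10 * b.b12 = 0 ∧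
    2 * a.a9 * (b.b16 + b.b17) - 3 * a.a4 * b.b14 - 6 * a.a11 * b.b12 = 0 ∧
    6 * a.a9 * b.b15 + 2 * a.a9 * (b.b16 + b.b17) - 18 * a.a11 * b.b12 = 0 ∧
    4 * a.a9 * (b.b16 + b.b17) - 2 * a.a3 * b.b13 - 18 * a.a11 * b.b12 = 0 ∧
    2 * a.a9 * (b.b19 + b.b20) - a.a3 * b.b15 - 15 * a.a12 * b.b12 = 0 ∧
    12 * a.a9 * (b.b19 + b.b20) - 2 * a.a4 * (b.b16 + b.b17) - 60 * a.a12 * b.b12 = 0 ∧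
    20 * a.a9 * b.b18 + 8 * a.a9 * (b.b19 + b.b20) - a.a4 * b.b15 - 60 * a.a12 * b.b12 = 0 ∧
    6 * a.a9 * b.b13 - 2 * a.a1 * b.b13 - 18 * a.a10 * b.b12 = 0 ∧
    3 * a.a9 * b.b15 - a.a1 * b.b15 - 6 * a.a11 * b.b12 = 0 ∧
    6 * a.a9 * b.b15 + 2 * a.a9 * (b.b16 + b.b17) - 2 * a.a1 * (b.b16 + b.b17) - 18 * a.a11 *
      b.b12 = 0 ∧
    10 * a.a9 * b.b18 + a.a9 * (b.b19 + b.b20) - a.a1 * (b.b19 + b.b20) - 15 * a.a12 * b.b12 = 0 ∧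
    12 * a.a9 * (b.b21 + b.b22) + a.a12 * b.b4 - a.a3 * b.b18 - a.a3 * (b.b19 + b.b20) - 2 * a.a4
      * b.b18 - 126 * a.a13 * b.b12 = 0 ∧
    3 * a.a9 * b.b14 + 2 * a.a9 * b.b13 - 3 * a.a1 * b.b14 - 9 * a.a10 * b.b12 = 0 ∧
    a.a12 * b.b11 - a.a8 * (b.b19 + b.b20) - 6 * a.a13 * (b.b21 + b.b22) - 8 * a.a8 * b.b18 = 0 ∧
    2 * a.a13 * b.b18 + a.a12 * b.b9 - a.a8 * b.b15 - a.a7 * b.b18 - a.a12 * (b.b21 + b.b22) = 0 ∧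
    2 * a.a11 * b.b11 + a.a12 * b.b10 - a.a7 * (b.b19 + b.b20) - 2 * a.a8 * (b.b16 + b.b17) - 4 *
      a.a13 * (b.b19 + b.b20) - 6 * a.a12 * (b.b21 + b.b22) - 6 * a.a7 * b.b18 - 8 * a.a8 * b.b15
      = 0 := by
  have h (x0 x1 x2 x3 y0 y1 y2 y3 : ℂ) := hab.URhs_jetPoint i
    (fun | 0 => x0 | 1 => x1 | 2 => x2 | 3 => x3 | _ => 0)
    (fun | 0 => y0 | 1 => y1 | 2 => y2 | 3 => y3 | _ => 0)
  simp only at h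
  refine ⟨?_, ?_, ?_, ?_, ?_, ?_, ?_, ?_, ?_, ?_, ?_, ?_, ?_, ?_, ?_, ?_, ?_, ?_, ?_, ?_,
    ?_, ?_, ?_, ?_⟩
  · linear_combination (-1) * h 0 0 0 0 1 0 0 1 + (1/2) * h 1 0 0 0 1 0 0 1 + (1/2) * h (-1) 0 0 0
      1 0 0 1
  · linear_combination (1/2) * h 1 0 0 0 1 0 0 1 + (-1/2) * h (-1) 0 0 0 1 0 0 1
  · linear_combination h 0 0 0 0 1 0 0 1
  · linear_combination (-1) * h 0 0 0 1 1 0 0 0 + (1/2) * h 1 0 0 1 1 0 0 0 + (1/2) * h (-1) 0 0 1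
      1 0 0 0
  · linear_combination (1/2) * h 1 0 0 1 1 0 0 0 + (-1/2) * h (-1) 0 0 1 1 0 0 0
  · linear_combination h 0 0 0 1 1 0 0 0
  · linear_combination (1024/1023) * h 0 1 0 0 1 0 0 0 + (-1/2046) * h 0 1 0 0 2 0 0 0
  · linear_combination h 1 1 0 0 0 0 1 0
  · linear_combination (-1) * h 1 0 0 0 0 1 0 0 + h 1 1 0 0 0 1 0 0
  · linear_combination (-1/3) * h 1 0 0 0 0 1 0 0 + (1/6) * h 1 0 0 0 0 2 0 0
  · linear_combination (-1) * h 0 0 0 0 1 1 0 0 + (1/2) * h 0 1 0 0 1 1 0 0 + (1/2) * h 0 (-1) 0 0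
      1 1 0 0
  · linear_combination h 0 1 0 0 1 0 0 0 + (-1) * h 0 1 0 0 1 0 1 0 + (-1) * h 1 1 0 0 1 0 0
      0 + (-1) * h 1 1 0 0 0 0 1 0 + h 1 1 0 0 1 0 1 0
  · linear_combination (-1) * h 0 1 0 0 1 0 0 0 + h 0 1 0 0 1 0 1 0
  · linear_combination (-256/255) * h 0 0 0 0 1 1 0 0 + (1/3) * h 1 0 0 0 0 1 0 0 + (1/4080) * h 0
      0 0 0 2 1 0 0 + (-1/3) * h 1 0 0 0 1 1 0 0 + (-1/6) * h 1 0 0 0 0 2 0 0 + (1/6) * h 1 0 0 0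
      1 2 0 0
  · linear_combination (-1) * h 0 1 0 0 1 0 0 0 + (1/2) * h 0 1 0 0 1 1 0 0 + (-1/2) * h 0 (-1) 0
      0 1 1 0 0
  · linear_combination h 0 1 0 0 1 0 0 0 + (-1) * h 1 1 0 0 1 0 0 0 + (-1) * h 0 1 1 0 1 0 0
      0 + h 1 1 1 0 1 0 0 0
  · linear_combination (-1) * h 0 1 0 0 1 0 0 0 + h 0 1 1 0 1 0 0 0
  · linear_combination h 0 0 0 0 1 1 0 0 + h 1 0 0 0 0 1 0 0 + (-1) * h 1 0 0 0 1 1 0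
      0 + (-1) * h 0 0 1 0 1 1 0 0 + (-1) * h 1 0 1 0 0 1 0 0 + h 1 0 1 0 1 1 0 0
  · linear_combination (-1) * h 0 0 0 0 1 1 0 0 + h 0 0 1 0 1 1 0 0
  · linear_combination (-1) * h 0 0 0 0 1 1 0 0 + h 0 0 0 0 1 1 1 0
  · linear_combination (-1) * h 1 0 0 0 0 1 0 0 + h 1 0 1 0 0 1 0 0
  · linear_combination (-1/255) * h 0 0 0 0 1 1 0 0 + (1/4080) * h 0 0 0 0 2 1 0 0
  · linear_combination (-1/1023) * h 0 1 0 0 1 0 0 0 + (1/2046) * h 0 1 0 0 2 0 0 0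
  · linear_combination (-1217/32130) * h 0 0 0 0 1 1 0 0 + (-229/1512) * h 1 0 0 0 0 1 0 0 +
      (-29/257040) * h 0 0 0 0 2 1 0 0 + (-88/945) * h 1 0 0 0 1 1 0 0 + (1/45) * h (-1) 0 0 0 1 1
      0 0 + (5/378) * h 1 0 0 0 0 2 0 0 + (1/1680) * h 1 0 0 0 2 1 0 0 + (-1/2160) * h (-1) 0 0 0
      2 1 0 0 + (5/378) * h 1 0 0 0 1 2 0 0 + (1/378) * h 2 0 0 0 1 1 0 0

/-! ### Scalings and the normal form. -/

@[simp]
theorem scaleSubst_du (ξ α β : ℂ) (k : ℕ) :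
    scaleSubst N ξ α β (du k) = MvPolynomial.C (α * (ξ ^ k)⁻¹) * du k := by
  simp [scaleSubst, du]

@[simp]
theorem scaleSubst_dU (ξ α β : ℂ) (k : ℕ) (j : Fin N) :
    scaleSubst N ξ α β (dU k j) = MvPolynomial.C (β * (ξ ^ k)⁻¹) * dU k j := by
  simp [scaleSubst, dU]

@[simp]
theorem scaleSubst_dot (ξ α β : ℂ) (m n : ℕ) :
    scaleSubst N ξ α β (dot m n) =
      MvPolynomial.C (β * (ξ ^ m)⁻¹) * MvPolynomial.C (β * (ξ ^ n)⁻¹) * dot m n := by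
  simp only [dot, map_sum, map_mul, scaleSubst_dU, Finset.mul_sum]
  exact Finset.sum_congr rfl fun j _ => by ring

/-- A system of the second-order ansatz whose coefficients satisfy these relations is a rescaling
of the target system. -/
theorem Coeffs2.eqUpToScaling_targetSystem (a : Coeffs2) (h1 : a.a1 ≠ 0) (h2 : a.a2 = 0)
    (h3 : a.a3 ≠ 0) (h4 : a.a4 = a.a3) (h5 : a.a5 = 0) (h6 : a.a6 = 0) (h7 : a.a7 = -2 * a.a13)
    (h8 : a.a1 * a.a8 = -a.a3 * a.a13) (h9 : a.a9 = 0) (h10 : a.a10 = 0) (h11 : a.a11 = 0)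
    (h12 : a.a3 * a.a12 = 2 * a.a1 * a.a13) (h13 : a.a13 ≠ 0) :
    EqUpToScaling (a.system N) (targetSystem N) := by
  obtain ⟨ξ, hξ⟩ := IsAlgClosed.exists_pow_nat_eq (-a.a1 / a.a13) two_pos
  have hξ0 : ξ ≠ 0 := by
    rintro rfl
    have : -a.a1 / a.a13 ≠ 0 := div_ne_zero (neg_ne_zero.2 h1) h13
    exact this (by rw [← hξ]; ring)
  have hξ' : (ξ ^ 2)⁻¹ = -a.a13 / a.a1 := by
    rw [hξ]; field_simp
  have h8' : a.a8 = -a.a3 * a.a13 / a.a1 := by field_simp; linear_combination h8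
  have h12' : a.a12 = 2 * a.a1 * a.a13 / a.a3 := by field_simp; linear_combination h12
  -- By weighted homogeneity `β = 1` costs nothing. Then `a13` fixes `τ`, the coefficient of `u_xx`
  -- fixes `ξ ^ 2`, and the ratio of `a3` to `a1` fixes `α`.
  refine ⟨-1 / a.a13, ξ, a.a3 / (2 * a.a1), 1, div_ne_zero (by norm_num) h13, hξ0,
    div_ne_zero h3 (mul_ne_zero two_ne_zero h1), one_ne_zero, ?_⟩
  have key (c d : ℂ) (hcd : c = d) :
      (MvPolynomial.C c : DiffPoly N) = MvPolynomial.C d := by rw [hcd]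
  ext1
  · have e1 := key (-1 / a.a13 * (a.a3 / (2 * a.a1))⁻¹ * a.a1 * (a.a3 / (2 * a.a1) * (ξ ^ 2)⁻¹)) 1
      (by rw [hξ']; field_simp)
    have e3 := key (-1 / a.a13 * (a.a3 / (2 * a.a1))⁻¹ * a.a3 * (ξ ^ 2)⁻¹) 2
      (by rw [hξ']; field_simp)
    have e7 := key (-1 / a.a13 * (a.a3 / (2 * a.a1))⁻¹ * a.a7 * (a.a3 / (2 * a.a1))) 2
      (by rw [h7]; field_simp)
    have e8 := key (-1 / a.a13 * (a.a3 / (2 * a.a1))⁻¹ * a.a8) 2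
      (by rw [h8']; field_simp)
    simp only [EvolutionSystem.rescale, Coeffs2.system, targetSystem, h2, h4, h5, h6,
      MvPolynomial.smul_eq_C_mul, map_add, map_mul, map_pow, scaleSubst_du, scaleSubst_dot,
      MvPolynomial.algHom_C, MvPolynomial.algebraMap_eq, map_zero, map_one, pow_zero, pow_one,
      inv_one, mul_one, one_mul, zero_mul, add_zero, map_ofNat] at e1 e3 e7 e8 ⊢
    -- The term `⟨U_x, U_x⟩` picks up `ξ⁻¹` from each factor, whereas `⟨U, U_xx⟩` picks up `(ξ ^
    -- 2)⁻¹` at once.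
    have e4 : (MvPolynomial.C (ξ ^ 2)⁻¹ : DiffPoly N) =
      MvPolynomial.C ξ⁻¹ * MvPolynomial.C ξ⁻¹ := by rw [← map_mul]; congr 1; ring
    linear_combination du 2 * e1 + dot 0 2 * e3 + dot 1 1 * e3 + du 0 * dot 0 0 ^ 3 * e7 +
      dot 0 0 ^ 4 * e8 - MvPolynomial.C (-1 / a.a13) *
        MvPolynomial.C (a.a3 / (2 * a.a1))⁻¹ * MvPolynomial.C a.a3 * dot 1 1 * e4
  · funext j
    have e12 := key (-1 / a.a13 * a.a12 * (a.a3 / (2 * a.a1))) (-1) (by rw [h12']; field_simp)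
    have e13 := key (-1 / a.a13 * a.a13) (-1) (by field_simp)
    simp only [EvolutionSystem.rescale, Coeffs2.system, targetSystem, h9, h10, h11,
      MvPolynomial.smul_eq_C_mul, map_add, map_mul, map_pow, map_neg, scaleSubst_du, scaleSubst_dU,
      scaleSubst_dot, MvPolynomial.algHom_C, MvPolynomial.algebraMap_eq, map_zero, map_one,
      pow_zero, pow_one, inv_one, mul_one, one_mul, zero_mul, zero_add] at e12 e13 ⊢
    linear_combination du 0 * dot 0 0 ^ 2 * dU 0 j * e12 + dot 0 0 ^ 3 * dU 0 j * e13

end ScalarVector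

end

/-! ### Elimination of the coefficients. -/

theorem mainTheorem6 (N : ℕ) (hN : 1 ≤ N) (a : ScalarVector.Coeffs2) (ha : a.Admissible)
    (hsymm : ∃ b : ScalarVector.Coeffs3, b.AdmissibleSymmetry ∧
      ScalarVector.IsSymmetry (b.system N) (a.system N)) :
    ScalarVector.EqUpToScaling (a.system N) (ScalarVector.targetSystem N) := by
  obtain ⟨b, ⟨hb, -, -⟩, hab⟩ := hsymm
  obtain ⟨ha₁, ha₂, ha₃⟩ := ha
  obtain ⟨w1, w2, w4, w5, w6, w7, w8, w9, w10, w11, w12, w13⟩ := hab.uRhs_coeffs ⟨0, hN⟩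
  obtain ⟨v1, v2, v3, v4, v5, v6, v7, v8, v9, v10, v11, v12, v13, v14, v15, v16, v17, v18, v19,
    v20, v21, v22, v23, v24⟩ := hab.URhs_coeffs ⟨0, hN⟩
  obtain ⟨a1, a2, a3, a4, a5, a6, a7, a8, a9, a10, a11, a12, a13⟩ := a
  obtain ⟨b1, b2, b3, b4, b5, b6, b7, b8, b9, b10, b11, b12, b13, b14, b15, b16, b17, b18, b19, b20,
    b21, b22⟩ := b
  clear hab
  simp only [ne_eq, Prod.mk.injEq, not_and] at *
  generalize b16 + b17 = c16 at *
  generalize b19 + b20 = c19 at *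
  generalize b21 + b22 = c21 at *
  -- The form in which the occurrence of `u` in the second equation is used: a factor annihilated by
  -- `a10`, `a11` and `a12` is zero.
  have cancel (x : ℂ) (h10 : a10 * x = 0) (h11 : a11 * x = 0) (h12 : a12 * x = 0) :
      x = 0 := by
    by_contra hx
    simp only [mul_eq_zero, hx, or_false] at h10 h11 h12
    exact ha₃ h10 h11 h12
  have h9 : a9 = 0 := by
    by_contra h
    -- `v7`, `v8`, `v9` are independent linear relations in `a9 * b13`, `a9 * b14`, `a10 * b12`, so
    -- all three products vanish. This decouples the relations involving `a11 * b12`, and these in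
    -- turn decouple those with `a12 * b12`.
    have x10 : a10 * b12 = 0 := by linear_combination (v9 - 2 * v7 - v8) / 3
    have y13 : b13 = 0 := (mul_eq_zero.1 (by linear_combination v7 / 2 + 3 * x10)).resolve_left h
    have y14 : b14 = 0 :=
      (mul_eq_zero.1 (by linear_combination v8 / 6 + 3 / 2 * x10)).resolve_left h
    subst y13
    subst y14
    have x11 : a11 * b12 = 0 := by linear_combination (v12 - 2 * v10) / (-6)
    have y16 : c16 = 0 := (mul_eq_zero.1 (by linear_combination v10 / 2 + 3 * x11)).resolve_left h
    subst y16
    have y15 : b15 = 0 := (mul_eq_zero.1 (by linear_combination v11 / 6 + 3 * x11)).resolve_left h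
    subst y15
    have x12 : a12 * b12 = 0 := by linear_combination (v14 - 6 * v13) / 30
    have y19 : c19 = 0 :=
      (mul_eq_zero.1 (by linear_combination v13 / 2 + 15 / 2 * x12)).resolve_left h
    subst y19
    have y18 : b18 = 0 := (mul_eq_zero.1 (by linear_combination v15 / 20 + 3 * x12)).resolve_left h
    subst y18
    refine hb (cancel _ ?_ ?_ ?_) (cancel _ ?_ ?_ ?_) (cancel _ x10 x11 x12)
    · linear_combination v4 / 3 + x10
    · linear_combination v5 / 2 + x11
    · linear_combination v6 + x12
    · linear_combination v1 / 3
    · linear_combination v2 / 2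
    · linear_combination v3
  subst h9
  have y12 : b12 = 0 := by
    by_contra h
    have x11 : a11 = 0 := (mul_eq_zero.1 (by linear_combination v11 / (-18))).resolve_right h
    refine h (cancel _ ?_ ?_ ?_)
    · linear_combination v7 / (-6)
    · rw [x11]; ring
    · subst x11
      linear_combination (v13 - v2) / (-15)
  subst y12
  have h1 : a1 ≠ 0 := by
    intro h
    subst h
    have y1 : b1 = 0 := cancel _ (by linear_combination v4 / 3) (by linear_combination v5 / 2)
      (by linear_combination v6)
    subst y1
    refine hb rfl (cancel _ ?_ ?_ ?_) rfl
    · linear_combination v1 / 3 - v12 / 6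
    · linear_combination v2 / 2 - v13 / 2
    -- The sum `w12 + v20` removes `b4` and `c19`, and `9 * v3` removes `a3 * b18`, leaving a
    -- multiple of `a12 * b3`.
    · linear_combination (w12 + v20 + 9 * v3) / (-6)
  have y13 : b13 = 0 := (mul_eq_zero.1 (by linear_combination v16 / (-2))).resolve_left h1
  have y14 : b14 = 0 :=
    (mul_eq_zero.1 (by subst y13; linear_combination v21 / (-3))).resolve_left h1
  have y15 : b15 = 0 := (mul_eq_zero.1 (by linear_combination -v17)).resolve_left h1
  have y16 : c16 = 0 := (mul_eq_zero.1 (by linear_combination v18 / (-2))).resolve_left h1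
  have y19 : c19 = 0 := (mul_eq_zero.1 (by linear_combination -v19)).resolve_left h1
  subst y13
  subst y14
  subst y15
  subst y16
  subst y19
  -- The common ratio: `b18 = a12 * k` and `b3 = a3 * k` follow below, and `k = 0` would make the
  -- third-order part of (2) vanish.
  obtain ⟨k, hk⟩ : ∃ k, b1 = a1 * k := ⟨b1 / a1, by field_simp⟩
  subst hk
  have y18 : b18 = a12 * k := mul_left_cancel₀ h1 (by linear_combination -v6)
  subst y18
  have hk0 : k ≠ 0 := by
    rintro rfl
    exact hb (by ring) (cancel _ (by linear_combination v1 / 3) (by linear_combination v2 / 2)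
      (by linear_combination v3)) rfl
  have h1k := mul_ne_zero h1 hk0
  have h10 : a10 = 0 := (mul_eq_zero.1 (by linear_combination v4 / 3)).resolve_right h1k
  have h11 : a11 = 0 := (mul_eq_zero.1 (by linear_combination v5 / 2)).resolve_right h1k
  have h12 : a12 ≠ 0 := ha₃ h10 h11
  subst h10
  subst h11
  have y3 : b3 = a3 * k := mul_left_cancel₀ h12 (by linear_combination v3)
  subst y3
  -- For `a2`, `a5` and `a6` in turn, the relations are more numerous than the new `b`'s they
  -- contain (`b2`; `b5`; `b7` and `b8`), and are consistent only if the `a` vanishes.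
  have h2 : a2 = 0 := by
    have y2 : b2 = 4 * a2 * k := mul_left_cancel₀ h1 (by linear_combination w2 / 6)
    refine (mul_eq_zero.1 (?_ : a2 * (a1 * k) = 0)).resolve_right h1k
    rw [y2] at w1
    linear_combination w1 / (-12)
  have h5 : a5 = 0 := (mul_eq_zero.1
    (by linear_combination (w4 - 2 * w5) / (-6))).resolve_right h1k
  subst h5
  have y5 : b5 = 0 := (mul_eq_zero.1 (by linear_combination w5 / 2)).resolve_left h1
  subst y5
  have h6 : a6 = 0 := (mul_eq_zero.1
    (by linear_combination (w8 + 6 * w6 - 2 * w7) / (-12))).resolve_right h1k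
  subst h6
  have y7 : b7 = 0 := (mul_eq_zero.1 (by linear_combination w6 / 2)).resolve_left h1
  subst y7
  have y8 : b8 = 0 := (mul_eq_zero.1 (by linear_combination w7 / 2)).resolve_left h1
  subst y8
  have y4 : b4 = 3 * a3 * k :=
    mul_left_cancel₀ h12 (by linear_combination (w11 - 15 * w9) / (-10))
  subst y4
  have h4 : a3 = a4 := mul_right_cancel₀ (mul_ne_zero h12 hk0) (by linear_combination v20 / 2)
  subst h4
  have y9 : b9 = a7 * k := mul_left_cancel₀ h1 (by linear_combination (w10 - 2 * w9) / 6)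
  subst y9
  have e3 : a12 * a3 = -a7 * a1 :=
    mul_right_cancel₀ hk0 (by linear_combination w12 / (-6))
  have y10 : b10 = 0 :=
    (mul_eq_zero.1 (by linear_combination w9 + 6 * k * e3)).resolve_left h1
  subst y10
  have y21 : c21 = -a7 * k := mul_left_cancel₀ h12 (by linear_combination v24 / (-6))
  subst y21
  have h7 : a7 = -2 * a13 :=
    mul_right_cancel₀ (mul_ne_zero h12 hk0) (by linear_combination v23)
  subst h7
  -- The coefficient `b11` occurs in both relations as a multiple of `a12 * b11` and cancels in `w13
  -- + 12 * v22`.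
  have e8 : a12 * a8 = -2 * a13 ^ 2 :=
    mul_right_cancel₀ hk0 (by linear_combination (w13 + 12 * v22) / (-96))
  have h8 : a1 * a8 = -a3 * a13 :=
    mul_left_cancel₀ h12 (by linear_combination a1 * e8 + a13 * e3)
  -- If `a3 = 0`, then `a4` through `a8` vanish as well and `U` drops out of the first equation.
  have h3 : a3 ≠ 0 := by
    intro h
    subst h
    have h13 : a13 = 0 := (mul_eq_zero.1 (by linear_combination e3 / (-2))).resolve_left h1
    have h8' : a8 = 0 := (mul_eq_zero.1 (by linear_combination h8)).resolve_left h1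
    exact ha₂ rfl rfl rfl rfl (by rw [h13]; ring) h8'
  refine ScalarVector.Coeffs2.eqUpToScaling_targetSystem _ h1 h2 h3 rfl rfl rfl rfl h8 rfl rfl rfl
    (by linear_combination e3) fun h13 => ?_
  -- If `a13 = 0`, then `a7 = 0`, so `e3` would give `a12 * a3 = 0`.
  exact mul_ne_zero h12 h3 (by simp only at h13; linear_combination e3 + 2 * a1 * h13)
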